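/- Let $X$ be a uniformly convex (real or complex) Banach space with dual space $X^*$, and let $(x_k)_{k\ge 1}$ be a sequence in $X$ which is Cesàro shift-bounded, i.e. there is a constant $c>0$ such that $$\Big\|\sum_{j=1}^p x_{n_j+n}\Big\|\le c\,\Big\|\sum_{j=1}^p x_{n_j}\Big\|$$ for all integers $p\ge 1$, $1\le n_1<\dots<n_p$ and $n\ge 1$. Then the following conditions are equivalent: (i) $(x_k)_{k\ge1}$ is weakly mixing to zero, that is, $\displaystyle\lim_{n\to\infty}\frac1n\sum_{k=1}^n|\langle x^*,x_k\rangle|=0$ for all $x^*\in X^*$; (ii) $(x_k)_{k\ge1}$ is uniformly weakly mixing to zero, that is, $\displaystyle\lim_{n\to\infty}\sup\Big\{\frac1n\sum_{k=1}^n|\langle x^*,x_k\rangle| : x^*\in X^*,\ \|x^*\|\le1\Big\}=0$; (iii) $\displaystyle\lim_{\substack{a,b\ge 1\\ b-a\to\infty}}\sup\Big\{\frac1{b-a+1}\sum_{k=a}^b|\langle x^*,x_k\rangle| : x^*\in X^*,\ \|x^*\|\le1\Big\}=0$, where $a,b$ range over the positive integers. -/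

import Mathlib

open Filter Topology

/-! Sequences `(x_k)_{k ≥ 1}` are represented by functions `x : ℕ → X`; the value `x 0` is never
used in any of the notions below. -/

/-- `(x_k)_{k ≥ 1}` is Cesàro shift-bounded: for some constant `c > 0`, all finite sets
`F = {n_1 < ... < n_p}` of positive integers and all `n ≥ 1`,
`‖x_{n_1+n} + ... + x_{n_p+n}‖ ≤ c ‖x_{n_1} + ... + x_{n_p}‖`
(for empty `F` this is the trivial inequality `0 ≤ 0`). -/
def CesaroShiftBounded {X : Type*} [NormedAddCommGroup X] (x : ℕ → X) : Prop :=
  ∃ c : ℝ, 0 < c ∧ ∀ F : Finset ℕ, (∀ j ∈ F, 1 ≤ j) → ∀ n : ℕ, 1 ≤ n →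
    ‖∑ j ∈ F, x (j + n)‖ ≤ c * ‖∑ j ∈ F, x j‖

/-- `(1/n) ∑_{k=1}^n |⟨x*, x_k⟩| → 0` for every `x*` in the (topological) dual. -/
def WeaklyMixingToZero (𝕜 : Type*) {X : Type*} [RCLike 𝕜] [NormedAddCommGroup X]
    [NormedSpace 𝕜 X] (x : ℕ → X) : Prop :=
  ∀ f : X →L[𝕜] 𝕜,
    Tendsto (fun n : ℕ => 1 / (n : ℝ) * ∑ k ∈ Finset.Icc 1 n, ‖f (x k)‖) atTop (𝓝 0)

/-- `sup {(1/n) ∑_{k=1}^n |⟨x*, x_k⟩| ; ‖x*‖ ≤ 1} → 0` as `n → ∞`. -/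
def UniformlyWeaklyMixingToZero (𝕜 : Type*) {X : Type*} [RCLike 𝕜] [NormedAddCommGroup X]
    [NormedSpace 𝕜 X] (x : ℕ → X) : Prop :=
  Tendsto
    (fun n : ℕ => sSup {r : ℝ | ∃ f : X →L[𝕜] 𝕜, ‖f‖ ≤ 1 ∧
      r = 1 / (n : ℝ) * ∑ k ∈ Finset.Icc 1 n, ‖f (x k)‖})
    atTop (𝓝 0)

/-- `sup {(1/(b-a+1)) ∑_{k=a}^b |⟨x*, x_k⟩| ; ‖x*‖ ≤ 1} → 0` as `b - a → ∞`, where `a, b` range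
over the positive integers; the difference `b - a` is taken in `ℤ`. -/
def WindowUniformlyWeaklyMixingToZero (𝕜 : Type*) {X : Type*} [RCLike 𝕜] [NormedAddCommGroup X]
    [NormedSpace 𝕜 X] (x : ℕ → X) : Prop :=
  Tendsto
    (fun p : ℕ × ℕ => sSup {r : ℝ | ∃ f : X →L[𝕜] 𝕜, ‖f‖ ≤ 1 ∧
      r = 1 / ((p.2 : ℝ) - (p.1 : ℝ) + 1) * ∑ k ∈ Finset.Icc p.1 p.2, ‖f (x k)‖})
    (comap (fun p : ℕ × ℕ => (p.2 : ℤ) - (p.1 : ℤ)) atTop ⊓ 𝓟 {p : ℕ × ℕ | 1 ≤ p.1 ∧ 1 ≤ p.2})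
    (𝓝 0)

/-- The sets whose suprema are taken above are bounded above (and they contain `0`, by `f = 0`),
so that `sSup` is the genuine supremum. -/
theorem bddAbove_weakMeans (𝕜 : Type*) {X : Type*} [RCLike 𝕜] [NormedAddCommGroup X]
    [NormedSpace 𝕜 X] (x : ℕ → X) (w : ℝ) (hw : 0 ≤ w) (s : Finset ℕ) :
    BddAbove {r : ℝ | ∃ f : X →L[𝕜] 𝕜, ‖f‖ ≤ 1 ∧ r = w * ∑ k ∈ s, ‖f (x k)‖} := by
  refine ⟨w * ∑ k ∈ s, ‖x k‖, ?_⟩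
  rintro r ⟨f, hf, rfl⟩
  refine mul_le_mul_of_nonneg_left (Finset.sum_le_sum fun k _ => ?_) hw
  exact f.le_of_opNorm_le_of_le hf le_rfl |>.trans (by simp)

/-! The substance is (i) ⇒ (iii). Weak mixing supplies late indices at which finitely many
prescribed functionals are small. By uniform convexity, a block of indices can then be joined to a
later block on which the norming functionals of its subset sums are small, and subset sums grow by a
factor θ < 2 while the cardinality doubles. This yields a finite set F whose subset sums are all at
most ε|F|. Shift-boundedness carries this bound, up to the factor c, to every translate F + n.
Control of all subset sums controls ∑ |f(x_k)| over F + n, uniformly for ‖f‖ ≤ 1. Averaging over n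
in a window gives (iii), with a boundary error independent of the window. -/

/-- A vector `v` that is almost annihilated by a norming functional of `u` is far from `u`, so that
in a uniformly convex space `‖u + v‖` is smaller than the triangle inequality predicts. -/
theorem UniformConvexSpace.exists_norm_add_le_of_norming (𝕜 : Type*) [RCLike 𝕜] (X : Type*)
    [NormedAddCommGroup X] [NormedSpace 𝕜 X] [UniformConvexSpace X] :
    ∃ θ : ℝ, 0 < θ ∧ θ < 2 ∧ ∀ (R : ℝ) (u v : X) (g : X →L[𝕜] 𝕜), 0 < R → ‖u‖ ≤ R → ‖v‖ ≤ R →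
      ‖g‖ ≤ 1 → g u = (‖u‖ : 𝕜) → ‖g v‖ ≤ R / 4 → ‖u + v‖ ≤ θ * R := by
  let _ : NormedSpace ℝ X := NormedSpace.restrictScalars ℝ 𝕜 X
  obtain ⟨δ, hδ, h⟩ := exists_forall_closed_ball_dist_add_le_two_sub X
    (show (0 : ℝ) < 1 / 4 by norm_num)
  -- 3/2 covers ‖u‖ ≤ R/2 by the triangle inequality; 2 - δ covers the rest, where u/R and v/R are
  -- at least 1/4 apart.
  refine ⟨max (2 - δ) (3 / 2), by positivity, by simp [hδ]; norm_num, ?_⟩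
  intro R u v g hR hu hv hg hgu hgv
  rcases le_total ‖u‖ (R / 2) with h2 | h2
  · calc ‖u + v‖ ≤ ‖u‖ + ‖v‖ := norm_add_le _ _
      _ ≤ 3 / 2 * R := by linarith
      _ ≤ _ := by gcongr; exact le_max_right _ _
  · have hd : R / 4 ≤ ‖u - v‖ := by
      have h3 : ‖g (u - v)‖ ≤ ‖u - v‖ := (g.le_of_opNorm_le hg _).trans (by simp)
      have h4 : ‖g u‖ - ‖g v‖ ≤ ‖g (u - v)‖ := by rw [map_sub]; exact norm_sub_norm_le _ _
      have h5 : ‖g u‖ = ‖u‖ := by rw [hgu]; simp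
      linarith
    have hs : ∀ w : X, ‖R⁻¹ • w‖ = R⁻¹ * ‖w‖ := fun w => by
      rw [norm_smul, Real.norm_of_nonneg (by positivity)]
    have hle : ∀ w : X, ‖w‖ ≤ R → ‖R⁻¹ • w‖ ≤ 1 := fun w hw => by
      rw [hs, inv_mul_le_iff₀ hR]; simpa using hw
    have key := h (hle u hu) (hle v hv) (by
      rw [← smul_sub, hs, le_inv_mul_iff₀ hR]; linarith)
    rw [← smul_add, hs, inv_mul_le_iff₀ hR] at key
    calc ‖u + v‖ ≤ R * (2 - δ) := key
      _ ≤ max (2 - δ) (3 / 2) * R := by rw [mul_comm]; gcongr; exact le_max_left _ _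

/-- The terms of each sign form a subset, so each sign contributes at most A. -/
theorem Finset.sum_abs_le_two_mul_of_subset_sums {ι : Type*} (F : Finset ι) (r : ι → ℝ) (A : ℝ)
    (h : ∀ G ⊆ F, |∑ k ∈ G, r k| ≤ A) : ∑ k ∈ F, |r k| ≤ 2 * A := by
  classical
  have h1 := h _ (Finset.filter_subset (fun k => 0 ≤ r k) F)
  have h2 := h _ (Finset.filter_subset (fun k => ¬ 0 ≤ r k) F)
  rw [← Finset.sum_filter_add_sum_filter_not F (fun k => 0 ≤ r k) (fun k => |r k|)]
  have e1 : ∑ k ∈ F with 0 ≤ r k, |r k| = ∑ k ∈ F with 0 ≤ r k, r k :=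
    Finset.sum_congr rfl fun k hk => abs_of_nonneg (Finset.mem_filter.1 hk).2
  have e2 : ∑ k ∈ F with ¬ 0 ≤ r k, |r k| = -∑ k ∈ F with ¬ 0 ≤ r k, r k := by
    rw [← Finset.sum_neg_distrib]
    exact Finset.sum_congr rfl fun k hk => abs_of_neg (not_le.1 (Finset.mem_filter.1 hk).2)
  rw [e1, e2]
  linarith [le_of_abs_le h1, neg_le_of_abs_le h2]

theorem Finset.sum_norm_le_four_mul_of_subset_sums {ι 𝕜 : Type*} [RCLike 𝕜] (F : Finset ι)
    (z : ι → 𝕜) (A : ℝ) (h : ∀ G ⊆ F, ‖∑ k ∈ G, z k‖ ≤ A) : ∑ k ∈ F, ‖z k‖ ≤ 4 * A := by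
  have hre := F.sum_abs_le_two_mul_of_subset_sums (fun k => RCLike.re (z k)) A fun G hG => by
    rw [← map_sum]; exact (RCLike.abs_re_le_norm _).trans (h G hG)
  have him := F.sum_abs_le_two_mul_of_subset_sums (fun k => RCLike.im (z k)) A fun G hG => by
    rw [← map_sum]; exact (RCLike.abs_im_le_norm _).trans (h G hG)
  calc ∑ k ∈ F, ‖z k‖ ≤ ∑ k ∈ F, (|RCLike.re (z k)| + |RCLike.im (z k)|) :=
        Finset.sum_le_sum fun k _ => by
          conv_lhs => rw [← RCLike.re_add_im (z k)]
          refine (norm_add_le _ _).trans ?_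
          rw [norm_mul, RCLike.norm_ofReal, RCLike.norm_ofReal]
          gcongr
          refine mul_le_of_le_one_right (abs_nonneg _) ?_
          -- `RCLike.I` vanishes in the real case.
          by_cases hI : (RCLike.I : 𝕜) = 0
          · simp [hI]
          · exact (RCLike.norm_I_of_ne_zero hI).le
    _ ≤ 4 * A := by rw [Finset.sum_add_distrib]; linarith

/-- Weak mixing to zero makes finitely many functionals simultaneously small at arbitrarily large
indices. -/
theorem WeaklyMixingToZero.exists_gt_forall_norm_le {𝕜 X : Type*} [RCLike 𝕜]
    [NormedAddCommGroup X] [NormedSpace 𝕜 X] {x : ℕ → X} (hx : WeaklyMixingToZero 𝕜 x)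
    (Φ : Finset (X →L[𝕜] 𝕜)) {η : ℝ} (hη : 0 < η) (N : ℕ) :
    ∃ k, N < k ∧ ∀ g ∈ Φ, ‖g (x k)‖ ≤ η := by
  by_contra! hcon
  have hlim : Tendsto (fun n : ℕ => ∑ g ∈ Φ, 1 / (n : ℝ) * ∑ k ∈ Finset.Icc 1 n, ‖g (x k)‖)
      atTop (𝓝 0) := by
    simpa using tendsto_finsetSum Φ fun g _ => hx g
  -- Beyond 2N, more than half of the indices up to n exceed N; each contributes more than η, so the
  -- mean cannot be below η/2.
  obtain ⟨n, hn, hnN⟩ := ((hlim.eventually (gt_mem_nhds (half_pos hη))).and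
    (eventually_ge_atTop (2 * N + 1))).exists
  have hpos : (0 : ℝ) < n := by exact_mod_cast (by omega : 0 < n)
  rw [← Finset.mul_sum, Finset.sum_comm, one_div, inv_mul_lt_iff₀ hpos] at hn
  have h1 : ∑ k ∈ Finset.Icc (N + 1) n, η ≤ ∑ k ∈ Finset.Icc (N + 1) n, ∑ g ∈ Φ, ‖g (x k)‖ := by
    refine Finset.sum_le_sum fun k hk => ?_
    obtain ⟨g, hg, hlt⟩ := hcon k (by have := (Finset.mem_Icc.1 hk).1; omega)
    exact hlt.le.trans (Finset.single_le_sum (f := fun g : X →L[𝕜] 𝕜 => ‖g (x k)‖)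
      (fun _ _ => norm_nonneg _) hg)
  have h2 : ∑ k ∈ Finset.Icc (N + 1) n, ∑ g ∈ Φ, ‖g (x k)‖
      ≤ ∑ k ∈ Finset.Icc 1 n, ∑ g ∈ Φ, ‖g (x k)‖ :=
    Finset.sum_le_sum_of_subset_of_nonneg (Finset.Icc_subset_Icc_left (by omega))
      fun _ _ _ => Finset.sum_nonneg fun _ _ => norm_nonneg _
  have hcard : n + 1 - (N + 1) = n - N := by omega
  rw [Finset.sum_const, Nat.card_Icc, hcard, nsmul_eq_mul, Nat.cast_sub (by omega)] at h1
  have hN : (2 * N + 1 : ℝ) ≤ n := by exact_mod_cast hnN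
  nlinarith

/-- A Banach–Saks type selection: if 0 is approximated weakly along `x`, then a uniformly convex
space admits sets of `2 ^ j` indices all of whose subset sums are at most `θ ^ j * M`, `θ < 2`. -/
theorem exists_finset_norm_sum_subset_le {𝕜 X : Type*} [RCLike 𝕜] [NormedAddCommGroup X]
    [NormedSpace 𝕜 X] {x : ℕ → X} {θ M : ℝ} (hθ : 0 < θ) (hM : 0 < M)
    (hconv : ∀ (R : ℝ) (u v : X) (g : X →L[𝕜] 𝕜), 0 < R → ‖u‖ ≤ R → ‖v‖ ≤ R →
      ‖g‖ ≤ 1 → g u = (‖u‖ : 𝕜) → ‖g v‖ ≤ R / 4 → ‖u + v‖ ≤ θ * R)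
    (hbdd : ∀ k, 1 ≤ k → ‖x k‖ ≤ M)
    (hsel : ∀ (Φ : Finset (X →L[𝕜] 𝕜)) (η : ℝ), 0 < η → ∀ N : ℕ,
      ∃ k, N < k ∧ ∀ g ∈ Φ, ‖g (x k)‖ ≤ η) (j : ℕ) :
    ∀ (Φ : Finset (X →L[𝕜] 𝕜)) (η : ℝ), 0 < η → ∀ N : ℕ, ∃ F : Finset ℕ, F.card = 2 ^ j ∧
      (∀ k ∈ F, N < k) ∧ (∀ k ∈ F, ∀ g ∈ Φ, ‖g (x k)‖ ≤ η) ∧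
      ∀ G ⊆ F, ‖∑ k ∈ G, x k‖ ≤ θ ^ j * M := by
  classical
  induction j with
  | zero =>
    intro Φ η hη N
    obtain ⟨k, hk, hg⟩ := hsel Φ η hη N
    refine ⟨{k}, by simp, by simpa using hk, by simpa using hg, fun G hG => ?_⟩
    rcases Finset.subset_singleton_iff.1 hG with rfl | rfl
    · simpa using hM.le
    · simpa using hbdd k (by omega)
  | succ j ih =>
    intro Φ η hη N
    obtain ⟨F₁, hc₁, hN₁, hΦ₁, hs₁⟩ := ih Φ η hη N
    choose nf hnf1 hnf2 using fun u : X => exists_dual_vector'' 𝕜 u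
    have hR : 0 < θ ^ j * M := by positivity
    -- The second block is nearly annihilated by the norming functionals of all subset sums of F₁.
    -- The division by 2 ^ j = |F₂| lets the errors add up to at most R/4; starting beyond max F₁
    -- makes the blocks disjoint.
    obtain ⟨F₂, hc₂, hN₂, hΦ₂, hs₂⟩ := ih
      (Φ ∪ F₁.powerset.image fun G => nf (∑ k ∈ G, x k))
      (min η (θ ^ j * M / 4 / 2 ^ j)) (by positivity) (max N (F₁.sup id))
    have hlt : ∀ k ∈ F₁, ∀ l ∈ F₂, k < l := fun k hk l hl =>
      (Finset.le_sup (f := id) hk).trans_lt ((le_max_right _ _).trans_lt (hN₂ l hl))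
    have hdisj : Disjoint F₁ F₂ := Finset.disjoint_left.2 fun k h1 h2 => (hlt k h1 k h2).false
    refine ⟨F₁ ∪ F₂, ?_, ?_, ?_, ?_⟩
    · rw [Finset.card_union_of_disjoint hdisj, hc₁, hc₂]; ring
    · intro k hk
      rcases Finset.mem_union.1 hk with h | h
      · exact hN₁ k h
      · exact (le_max_left _ _).trans_lt (hN₂ k h)
    · intro k hk g hg
      rcases Finset.mem_union.1 hk with h | h
      · exact hΦ₁ k h g hg
      · exact (hΦ₂ k h g (Finset.mem_union_left _ hg)).trans (min_le_left _ _)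
    · intro G hG
      have hsplit : ∑ k ∈ G, x k = ∑ k ∈ G ∩ F₁, x k + ∑ k ∈ G ∩ F₂, x k := by
        rw [← Finset.sum_union (hdisj.mono Finset.inter_subset_right Finset.inter_subset_right),
          ← Finset.inter_union_distrib_left, Finset.inter_eq_left.2 hG]
      rw [hsplit, pow_succ', mul_assoc]
      refine hconv _ _ _ (nf (∑ k ∈ G ∩ F₁, x k)) hR (hs₁ _ Finset.inter_subset_right)
        (hs₂ _ Finset.inter_subset_right) (hnf1 _) (hnf2 _) ?_
      have hmem : nf (∑ k ∈ G ∩ F₁, x k) ∈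
          Φ ∪ F₁.powerset.image fun G => nf (∑ k ∈ G, x k) :=
        Finset.mem_union_right _ (Finset.mem_image.2
          ⟨G ∩ F₁, Finset.mem_powerset.2 Finset.inter_subset_right, rfl⟩)
      rw [map_sum]
      calc ‖∑ k ∈ G ∩ F₂, nf (∑ k ∈ G ∩ F₁, x k) (x k)‖
          ≤ ∑ k ∈ G ∩ F₂, ‖nf (∑ k ∈ G ∩ F₁, x k) (x k)‖ := norm_sum_le _ _
        _ ≤ ∑ k ∈ F₂, ‖nf (∑ k ∈ G ∩ F₁, x k) (x k)‖ :=
            Finset.sum_le_sum_of_subset_of_nonneg Finset.inter_subset_right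
              fun _ _ _ => norm_nonneg _
        _ ≤ ∑ k ∈ F₂, θ ^ j * M / 4 / 2 ^ j :=
            Finset.sum_le_sum fun k hk => (hΦ₂ k hk _ hmem).trans (min_le_right _ _)
        _ = θ ^ j * M / 4 := by
            rw [Finset.sum_const, hc₂, nsmul_eq_mul]; push_cast; field_simp

theorem CesaroShiftBounded.exists_norm_le {X : Type*} [NormedAddCommGroup X] {x : ℕ → X}
    (hx : CesaroShiftBounded x) : ∃ M : ℝ, 0 < M ∧ ∀ k, 1 ≤ k → ‖x k‖ ≤ M := by
  obtain ⟨c, hc, h⟩ := hx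
  refine ⟨(1 + c) * ‖x 1‖ + 1, by positivity, fun k hk => ?_⟩
  have h0 := norm_nonneg (x 1)
  have h1 : 0 ≤ c * ‖x 1‖ := by positivity
  obtain rfl | hk' := hk.eq_or_lt
  · linarith
  · have := h {1} (by simp) (k - 1) (by omega)
    simp only [Finset.sum_singleton, Nat.add_sub_cancel' hk] at this
    linarith

/-- A finite set of positive indices with uniformly small weak mean. -/
theorem WeaklyMixingToZero.exists_finset_norm_sum_subset_le {𝕜 X : Type*} [RCLike 𝕜]
    [NormedAddCommGroup X] [NormedSpace 𝕜 X] [UniformConvexSpace X] {x : ℕ → X}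
    (hx : WeaklyMixingToZero 𝕜 x) {M : ℝ} (hM : 0 < M) (hbdd : ∀ k, 1 ≤ k → ‖x k‖ ≤ M)
    {ε : ℝ} (hε : 0 < ε) :
    ∃ F : Finset ℕ, F.Nonempty ∧ (∀ k ∈ F, 1 ≤ k) ∧
      ∀ G ⊆ F, ‖∑ k ∈ G, x k‖ ≤ ε * F.card := by
  obtain ⟨θ, hθ, hθ2, hconv⟩ := UniformConvexSpace.exists_norm_add_le_of_norming 𝕜 X
  obtain ⟨j, hj⟩ := exists_pow_lt_of_lt_one (div_pos hε hM) (show θ / 2 < 1 by linarith)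
  obtain ⟨F, hcard, hpos, -, hF⟩ := _root_.exists_finset_norm_sum_subset_le hθ hM hconv hbdd
    (fun Φ η hη N => hx.exists_gt_forall_norm_le Φ hη N) j ∅ 1 one_pos 0
  refine ⟨F, Finset.card_pos.1 (by rw [hcard]; positivity), hpos, fun G hG => (hF G hG).trans ?_⟩
  rw [div_pow, lt_div_iff₀ hM, div_mul_eq_mul_div, div_lt_iff₀ (by positivity)] at hj
  rw [hcard]; push_cast; exact hj.le

/-- Shifting a window by `k` costs at most the `k` initial terms. -/
theorem sum_Icc_le_sum_Icc_add {h : ℕ → ℝ} (h0 : ∀ i, 0 ≤ h i) {M : ℝ}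
    (hM : ∀ i, 1 ≤ i → h i ≤ M) {a : ℕ} (ha : 1 ≤ a) (b k : ℕ) :
    ∑ i ∈ Finset.Icc a b, h i ≤ ∑ n ∈ Finset.Icc a b, h (k + n) + k * M := by
  have hsub : Finset.Icc a b ⊆ (Finset.Icc a b).map (addLeftEmbedding k) ∪ Finset.Ico a (a + k) := by
    intro i hi
    simp only [Finset.mem_union, Finset.mem_map, Finset.mem_Icc, Finset.mem_Ico,
      addLeftEmbedding_apply] at hi ⊢
    by_cases hik : i < a + k
    · exact Or.inr ⟨hi.1, hik⟩
    · exact Or.inl ⟨i - k, by omega, by omega⟩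
  calc ∑ i ∈ Finset.Icc a b, h i
      ≤ ∑ i ∈ (Finset.Icc a b).map (addLeftEmbedding k) ∪ Finset.Ico a (a + k), h i :=
        Finset.sum_le_sum_of_subset_of_nonneg hsub fun _ _ _ => h0 _
    _ ≤ ∑ i ∈ (Finset.Icc a b).map (addLeftEmbedding k), h i
          + ∑ i ∈ Finset.Ico a (a + k), h i := by
        rw [← Finset.sum_union_inter]
        exact le_add_of_nonneg_right (Finset.sum_nonneg fun _ _ => h0 _)
    _ ≤ _ := by
        rw [Finset.sum_map]
        refine add_le_add le_rfl ((Finset.sum_le_card_nsmul _ _ M fun i hi => ?_).trans ?_)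
        · exact hM i (ha.trans (Finset.mem_Ico.1 hi).1)
        · simp

/-- A finite set with small subset sums controls all long windows of a Cesàro shift-bounded
sequence, uniformly over the dual unit ball. -/
theorem sum_Icc_norm_le_of_finset {𝕜 X : Type*} [RCLike 𝕜] [NormedAddCommGroup X]
    [NormedSpace 𝕜 X] {x : ℕ → X} {c M ε : ℝ} (hc : 0 < c)
    (hx : ∀ F : Finset ℕ, (∀ j ∈ F, 1 ≤ j) → ∀ n : ℕ, 1 ≤ n →
      ‖∑ j ∈ F, x (j + n)‖ ≤ c * ‖∑ j ∈ F, x j‖)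
    (hM : 0 < M) (hbdd : ∀ k, 1 ≤ k → ‖x k‖ ≤ M) {F : Finset ℕ} (hne : F.Nonempty)
    (hF1 : ∀ k ∈ F, 1 ≤ k) (hF : ∀ G ⊆ F, ‖∑ k ∈ G, x k‖ ≤ ε * F.card)
    {f : X →L[𝕜] 𝕜} (hf : ‖f‖ ≤ 1) {a : ℕ} (ha : 1 ≤ a) (b : ℕ) :
    ∑ i ∈ Finset.Icc a b, ‖f (x i)‖
      ≤ 4 * c * ε * (Finset.Icc a b).card + (F.sup id : ℕ) * M := by
  have hfle : ∀ y : X, ‖f y‖ ≤ ‖y‖ := fun y => (f.le_of_opNorm_le hf y).trans (by simp)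
  have hshift : ∀ n ∈ Finset.Icc a b, ∑ k ∈ F, ‖f (x (k + n))‖ ≤ 4 * (c * (ε * F.card)) := by
    intro n hn
    refine F.sum_norm_le_four_mul_of_subset_sums _ _ fun G hG => ?_
    rw [← map_sum]
    refine (hfle _).trans ((hx G (fun j hj => hF1 j (hG hj)) n
      (ha.trans (Finset.mem_Icc.1 hn).1)).trans ?_)
    gcongr
    exact hF G hG
  have hcard : (0 : ℝ) < F.card := by exact_mod_cast hne.card_pos
  refine le_of_mul_le_mul_left ?_ hcard
  -- Double counting: the window is compared with its shift by each k ∈ F, then the order of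
  -- summation is exchanged.
  calc (F.card : ℝ) * ∑ i ∈ Finset.Icc a b, ‖f (x i)‖
      = ∑ k ∈ F, ∑ i ∈ Finset.Icc a b, ‖f (x i)‖ := by rw [Finset.sum_const, nsmul_eq_mul]
    _ ≤ ∑ k ∈ F, (∑ n ∈ Finset.Icc a b, ‖f (x (k + n))‖ + (F.sup id : ℕ) * M) := by
        refine Finset.sum_le_sum fun k hk => ?_
        refine (sum_Icc_le_sum_Icc_add (h := fun i => ‖f (x i)‖) (fun _ => norm_nonneg _)
          (fun i hi => (hfle _).trans (hbdd i hi)) ha b k).trans ?_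
        gcongr
        exact Finset.le_sup (f := id) hk
    _ = ∑ n ∈ Finset.Icc a b, ∑ k ∈ F, ‖f (x (k + n))‖ + F.card * ((F.sup id : ℕ) * M) := by
        rw [Finset.sum_add_distrib, Finset.sum_comm, Finset.sum_const, nsmul_eq_mul]
    _ ≤ (Finset.Icc a b).card • (4 * (c * (ε * F.card))) + F.card * ((F.sup id : ℕ) * M) := by
        gcongr
        exact Finset.sum_le_card_nsmul _ _ _ hshift
    _ = _ := by rw [nsmul_eq_mul]; ring

theorem WeaklyMixingToZero.windowUniformly {𝕜 X : Type*} [RCLike 𝕜] [NormedAddCommGroup X]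
    [NormedSpace 𝕜 X] [UniformConvexSpace X] {x : ℕ → X} (hx : CesaroShiftBounded x)
    (hmix : WeaklyMixingToZero 𝕜 x) : WindowUniformlyWeaklyMixingToZero 𝕜 x := by
  obtain ⟨M, hM, hbdd⟩ := hx.exists_norm_le
  obtain ⟨c, hc, hsb⟩ := hx
  refine Metric.tendsto_nhds.2 fun ε hε => ?_
  -- The main term becomes ε/4 per index, and L makes the boundary term less than ε/4 per index.
  obtain ⟨F, hne, hF1, hF⟩ := hmix.exists_finset_norm_sum_subset_le hM hbdd
    (show 0 < ε / (16 * c) by positivity)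
  obtain ⟨L, hL⟩ := exists_nat_gt ((F.sup id : ℕ) * M / (ε / 4))
  have hev : ∀ᶠ p : ℕ × ℕ in comap (fun p : ℕ × ℕ => (p.2 : ℤ) - (p.1 : ℤ)) atTop,
      (L : ℤ) ≤ (p.2 : ℤ) - (p.1 : ℤ) := tendsto_comap.eventually (eventually_ge_atTop (L : ℤ))
  filter_upwards [hev.filter_mono inf_le_left,
    (eventually_principal.2 fun p hp => hp : ∀ᶠ p in 𝓟 {p : ℕ × ℕ | 1 ≤ p.1 ∧ 1 ≤ p.2},
      1 ≤ p.1 ∧ 1 ≤ p.2).filter_mono inf_le_right]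
  rintro ⟨a, b⟩ hab ⟨ha, -⟩
  simp only at hab ha ⊢
  have hab' : a + L ≤ b := by omega
  have hlen : ((Finset.Icc a b).card : ℝ) = (b : ℝ) - a + 1 := by
    rw [Nat.card_Icc, Nat.cast_sub (by omega)]; push_cast; ring
  have hLlen : (L : ℝ) ≤ (b : ℝ) - a := by
    have : ((a + L : ℕ) : ℝ) ≤ b := by exact_mod_cast hab'
    push_cast at this; linarith
  have hpos : (0 : ℝ) < (b : ℝ) - a + 1 := by linarith [L.cast_nonneg (α := ℝ)]
  rw [Real.dist_eq, sub_zero, abs_of_nonneg]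
  · refine lt_of_le_of_lt (csSup_le ?_ ?_) (half_lt_self hε)
    · exact ⟨0, 0, by simp, by simp⟩
    rintro r ⟨f, hf, rfl⟩
    have key := sum_Icc_norm_le_of_finset hc hsb hM hbdd hne hF1 hF hf ha b
    rw [one_div, inv_mul_le_iff₀ hpos]
    rw [hlen] at key
    rw [div_lt_iff₀ (by positivity)] at hL
    have e : 4 * c * (ε / (16 * c)) = ε / 4 := by field_simp; norm_num
    rw [e] at key
    nlinarith
  · refine Real.sSup_nonneg ?_
    rintro r ⟨f, -, rfl⟩
    positivity

theorem WindowUniformlyWeaklyMixingToZero.uniformly {𝕜 X : Type*} [RCLike 𝕜]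
    [NormedAddCommGroup X] [NormedSpace 𝕜 X] {x : ℕ → X}
    (hx : WindowUniformlyWeaklyMixingToZero 𝕜 x) : UniformlyWeaklyMixingToZero 𝕜 x := by
  have hlim : Tendsto (fun n : ℕ => ((1, n) : ℕ × ℕ)) atTop
      (comap (fun p : ℕ × ℕ => (p.2 : ℤ) - (p.1 : ℤ)) atTop ⊓
        𝓟 {p : ℕ × ℕ | 1 ≤ p.1 ∧ 1 ≤ p.2}) := by
    refine tendsto_inf.2 ⟨tendsto_comap_iff.2 ?_, tendsto_principal.2 ?_⟩
    · exact tendsto_atTop_add_const_right atTop (-1 : ℤ) tendsto_natCast_atTop_atTop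
    · filter_upwards [eventually_ge_atTop 1] with n hn using ⟨le_rfl, hn⟩
  simpa [UniformlyWeaklyMixingToZero, Function.comp_def] using Tendsto.comp hx hlim

theorem UniformlyWeaklyMixingToZero.weaklyMixing {𝕜 X : Type*} [RCLike 𝕜]
    [NormedAddCommGroup X] [NormedSpace 𝕜 X] {x : ℕ → X}
    (hx : UniformlyWeaklyMixingToZero 𝕜 x) : WeaklyMixingToZero 𝕜 x := by
  intro f
  -- Normalizing by ‖f‖ + 1 avoids treating f = 0 separately.
  have hpos : 0 < ‖f‖ + 1 := by positivity
  have hlim := Tendsto.const_mul (‖f‖ + 1) hx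
  rw [mul_zero] at hlim
  refine squeeze_zero (fun n => by positivity) (fun n => ?_) hlim
  rw [← div_le_iff₀' hpos]
  refine le_csSup (bddAbove_weakMeans 𝕜 x (1 / (n : ℝ)) (by positivity) _)
    ⟨((‖f‖ + 1 : ℝ) : 𝕜)⁻¹ • f, ?_, ?_⟩
  · rw [norm_smul, norm_inv, RCLike.norm_ofReal, abs_of_pos hpos, inv_mul_le_iff₀ hpos]
    linarith
  · simp only [_root_.smul_apply, norm_smul, norm_inv, RCLike.norm_ofReal,
      abs_of_pos hpos, ← Finset.mul_sum]
    ring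

theorem theorem6p3 {𝕜 : Type*} [RCLike 𝕜] {X : Type*} [NormedAddCommGroup X] [NormedSpace 𝕜 X]
    [CompleteSpace X] [UniformConvexSpace X] (x : ℕ → X) (hx : CesaroShiftBounded x) :
    List.TFAE
      [WeaklyMixingToZero 𝕜 x,
       UniformlyWeaklyMixingToZero 𝕜 x,
       WindowUniformlyWeaklyMixingToZero 𝕜 x] := by
  tfae_have 1 → 3 := fun h => h.windowUniformly hx
  tfae_have 3 → 2 := fun h => h.uniformly
  tfae_have 2 → 1 := fun h => h.weaklyMixing
  tfae_finish
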